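/- **Theorem.** Let $k\ge 1$ and, for $i=1,\dots,k$, let $A_i\in\mathbb H^{p_i\times a_i}$, $B_i\in\mathbb H^{b_i\times q_i}$, $C_i\in\mathbb H^{p_i\times s_i}$, $D_i\in\mathbb H^{t_i\times q_i}$, $F_i\in\mathbb H^{p_i\times s_{i+1}}$, $G_i\in\mathbb H^{t_{i+1}\times q_i}$, $E_i\in\mathbb H^{p_i\times q_i}$ be matrices over the real quaternions $\mathbb H$. Write $r(\cdot)$ for the rank of a quaternion matrix (the dimension of its column space as a right $\mathbb H$-vector space). For $1\le m\le n\le k$ and sets $J,K\subseteq\{m,\dots,n+1\}$ put - $\mathcal E_{m,n}=\operatorname{diag}\bigl(E_m,-E_{m+1},\dots,(-1)^{n-m}E_n\bigr)$; - $\mathcal M^{J}_{m,n}=\begin{pmatrix}\mathcal C^{J}_{m,n}&\operatorname{diag}(A_m,\dots,A_n)\end{pmatrix}$, where $\mathcal C^{J}_{m,n}$ has block rows $i=m,\dots,n$ and block columns $j\in J$, with $(i,j)$ block equal to $C_i$ if $j=i$, to $F_i$ if $j=i+1$, and to $0$ otherwise; - $\mathcal N^{K}_{m,n}=\begin{pmatrix}\mathcal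 D^{K}_{m,n}\\ \operatorname{diag}(B_m,\dots,B_n)\end{pmatrix}$, where $\mathcal D^{K}_{m,n}$ has block rows $j\in K$ and block columns $i=m,\dots,n$, with $(j,i)$ block equal to $D_i$ if $j=i$, to $G_i$ if $j=i+1$, and to $0$ otherwise. Then the system $$A_iX_i+Y_iB_i+C_iZ_iD_i+F_iZ_{i+1}G_i=E_i\qquad(i=1,\dots,k)$$ has a solution in quaternion matrices $X_1,\dots,X_k$, $Y_1,\dots,Y_k$, $Z_1,\dots,Z_{k+1}$ of the appropriate sizes if and only if both of the following hold. (a) For every $1\le i\le k$, $$r\begin{pmatrix}E_i&A_i&C_i&F_i\\B_i&0&0&0\end{pmatrix}=r\begin{pmatrix}A_i&C_i&F_i\end{pmatrix}+r(B_i),\qquad r\begin{pmatrix}E_i&A_i\\B_i&0\\D_i&0\\G_i&0\end{pmatrix}=r\begin{pmatrix}B_i\\D_i\\G_i\end{pmatrix}+r(A_i),$$ $$r\begin{pmatrix}E_i&A_i&C_i\\B_i&0&0\\G_i&0&0\end{pmatrix}=r\begin{pmatrix}A_i&C_i\end{pmatrix}+r\begin{pmatrix}B_i\\G_i\end{pmatrix},\qquad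 r\begin{pmatrix}E_i&A_i&F_i\\B_i&0&0\\D_i&0&0\end{pmatrix}=r\begin{pmatrix}A_i&F_i\end{pmatrix}+r\begin{pmatrix}B_i\\D_i\end{pmatrix}.$$ (b) For all $1\le m\le n\le k$, the rank equality $$r\begin{pmatrix}\mathcal E_{m,n}&\mathcal M^{J}_{m,n}\\ \mathcal N^{K}_{m,n}&0\end{pmatrix}=r\bigl(\mathcal M^{J}_{m,n}\bigr)+r\bigl(\mathcal N^{K}_{m,n}\bigr)$$ holds for each of the four choices $$(J,K)=\bigl(\{m,\dots,n+1\},\{m+1,\dots,n\}\bigr),\quad \bigl(\{m+1,\dots,n\},\{m,\dots,n+1\}\bigr),$$ $$\bigl(\{m,\dots,n\},\{m+1,\dots,n+1\}\bigr),\quad \bigl(\{m+1,\dots,n+1\},\{m,\dots,n\}\bigr),$$ where $\{m+1,\dots,n\}=\emptyset$ if $m=n$. -/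

import Mathlib

open Matrix
open scoped Quaternion

/-- The rank `r(A)` of a quaternion matrix: the dimension of its column space as a *right*
vector space over the quaternions (a right vector space over `ℍ[ℝ]` is a module over the
opposite ring `ℍ[ℝ]ᵐᵒᵖ`). -/
noncomputable def quatRank {m n : Type*} (A : Matrix m n ℍ[ℝ]) : ℕ :=
  Module.finrank (ℍ[ℝ])ᵐᵒᵖ (Submodule.span (ℍ[ℝ])ᵐᵒᵖ (Set.range A.col))

/-- The data of the systems of Sylvester-type equations
`A i * X i + Y i * B i + C i * Z i * D i + F i * Z (i+1) * G i = E i`: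
the sizes and the coefficient matrices, all of them arbitrary.
Only the equations with index `1 ≤ i ≤ k` are used in a system of `k` equations. -/
structure SylvesterData where
  /-- number of rows of `E i` -/
  p : ℕ → ℕ
  /-- number of columns of `E i` -/
  q : ℕ → ℕ
  /-- number of rows of the unknown `X i` -/
  a : ℕ → ℕ
  /-- number of columns of the unknown `Y i` -/
  b : ℕ → ℕ
  /-- number of rows of the unknown `Z j` -/
  s : ℕ → ℕ
  /-- number of columns of the unknown `Z j` -/
  t : ℕ → ℕ
  A : ∀ i, Matrix (Fin (p i)) (Fin (a i)) ℍ[ℝ]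
  B : ∀ i, Matrix (Fin (b i)) (Fin (q i)) ℍ[ℝ]
  C : ∀ i, Matrix (Fin (p i)) (Fin (s i)) ℍ[ℝ]
  D : ∀ i, Matrix (Fin (t i)) (Fin (q i)) ℍ[ℝ]
  F : ∀ i, Matrix (Fin (p i)) (Fin (s (i + 1))) ℍ[ℝ]
  G : ∀ i, Matrix (Fin (t (i + 1))) (Fin (q i)) ℍ[ℝ]
  E : ∀ i, Matrix (Fin (p i)) (Fin (q i)) ℍ[ℝ]

namespace SylvesterData

variable (S : SylvesterData)

/-- The system formed by the equations `1, …, k` has a solution. -/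
def Consistent (k : ℕ) : Prop :=
  ∃ (X : ∀ i, Matrix (Fin (S.a i)) (Fin (S.q i)) ℍ[ℝ])
    (Y : ∀ i, Matrix (Fin (S.p i)) (Fin (S.b i)) ℍ[ℝ])
    (Z : ∀ j, Matrix (Fin (S.s j)) (Fin (S.t j)) ℍ[ℝ]),
    ∀ i, 1 ≤ i → i ≤ k →
      S.A i * X i + Y i * S.B i + S.C i * Z i * S.D i + S.F i * Z (i + 1) * S.G i = S.E i

/-- The block in block row `i` and block column `j` of the bidiagonal matrix formed by the
`C`'s and `F`'s: it is `C i` for `j = i`, `F i` for `j = i + 1`, and `0` otherwise. -/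
noncomputable def cfBlock (i j : ℕ) : Matrix (Fin (S.p i)) (Fin (S.s j)) ℍ[ℝ] :=
  if h : j = i then (S.C i).submatrix id (Fin.cast (congrArg S.s h))
  else if h : j = i + 1 then (S.F i).submatrix id (Fin.cast (congrArg S.s h))
  else 0

/-- The block in block row `j` and block column `i` of the bidiagonal matrix formed by the
`D`'s and `G`'s: it is `D i` for `j = i`, `G i` for `j = i + 1`, and `0` otherwise. -/
noncomputable def dgBlock (j i : ℕ) : Matrix (Fin (S.t j)) (Fin (S.q i)) ℍ[ℝ] :=
  if h : j = i then (S.D i).submatrix (Fin.cast (congrArg S.t h)) id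
  else if h : j = i + 1 then (S.G i).submatrix (Fin.cast (congrArg S.t h)) id
  else 0

/-- The block matrix with block rows `i ∈ [m, n]` (the equations), whose block columns are those
of the `C`-`F`-bidiagonal matrix with index `j ∈ J`, followed by those of
`diag(A m, …, A n)`. -/
noncomputable def acfMatrix (m n : ℕ) (J : Finset ℕ) :
    Matrix (Σ i : Finset.Icc m n, Fin (S.p i))
      ((Σ j : J, Fin (S.s j)) ⊕ (Σ i : Finset.Icc m n, Fin (S.a i))) ℍ[ℝ] :=
  Matrix.fromCols
    (Matrix.of fun r c => S.cfBlock r.1 c.1 r.2 c.2)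
    (Matrix.blockDiagonal' fun i : Finset.Icc m n => S.A i)

/-- The block matrix with block columns `i ∈ [m, n]` (the equations), whose block rows are those
of the `D`-`G`-bidiagonal matrix with index `j ∈ J`, followed by those of
`diag(B m, …, B n)`. -/
noncomputable def bdgMatrix (m n : ℕ) (J : Finset ℕ) :
    Matrix ((Σ j : J, Fin (S.t j)) ⊕ (Σ i : Finset.Icc m n, Fin (S.b i)))
      (Σ i : Finset.Icc m n, Fin (S.q i)) ℍ[ℝ] :=
  Matrix.fromRows
    (Matrix.of fun r c => S.dgBlock r.1 c.1 r.2 c.2)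
    (Matrix.blockDiagonal' fun i : Finset.Icc m n => S.B i)

/-- The block diagonal matrix `diag(E m, -E (m+1), …, (-1)^(n-m) E n)`. -/
noncomputable def eMatrix (m n : ℕ) :
    Matrix (Σ i : Finset.Icc m n, Fin (S.p i)) (Σ i : Finset.Icc m n, Fin (S.q i)) ℍ[ℝ] :=
  Matrix.blockDiagonal' fun i : Finset.Icc m n => (-1 : ℍ[ℝ]) ^ ((i : ℕ) - m) • S.E i

/-- The rank equality coupling the equations `m, …, n`, where the indices of the block columns
with `C`'s and `F`'s run over `J` and those of the block rows with `D`'s and `G`'s run over `K`.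
(The blocks are listed by kind; the order of block rows and block columns is irrelevant for the
rank.) -/
def CoupledRankEq (m n : ℕ) (J K : Finset ℕ) : Prop :=
  quatRank (Matrix.fromBlocks (S.eMatrix m n) (S.acfMatrix m n J) (S.bdgMatrix m n K) 0) =
    quatRank (S.acfMatrix m n J) + quatRank (S.bdgMatrix m n K)

end SylvesterData

/-!
Multiplying the equations by columns `x ∈ ker B i` and reading them modulo the column space of
`A i` eliminates the unknowns `X i` and `Y i`. What remains is to find linear maps `Z j` such that
`E i` and `C i * Z i * D i + F i * Z (i + 1) * G i` agree as maps from `ker B i` to the cokernel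
of `A i`. By additivity of dimension, an equality `r (E, M; N, 0) = r M + r N` says that
`E x` lies in the column space of `M` whenever `N x = 0` (`quatRank_fromBlocks_zero_iff`).
Applied to the coupled matrices, and after alternating signs, a vector killed by `N` is a *string*:
columns `u i ∈ ker B i` for `m ≤ i ≤ n` with `G i (u i) = D (i + 1) (u (i + 1))`, each end of
which may in addition be closed (`D m (u m) = 0`, respectively `G n (u n) = 0`). The four choices
of `(J, K)` are the four combinations of open and closed ends, and the rank equality says that
values of the unknowns `Z j` can be prescribed along the string so that the equations hold on it,
with the value `0` at a closed end (`SylvesterData.CoupledRankEq.exists_lift`).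

So every string can be solved separately, and the point is that these solutions fit together to
linear maps. The spaces `ker B i` and the maps `D i`, `G i` form a representation
`V 1 ← R 1 → V 2 ← R 2 → ⋯ → V (k + 1)` of a quiver of type `A`, and such a representation is a
direct sum of interval representations, that is, of strings. If a basis consists of strings, the
`Z j` may be defined on it by the solutions along these strings. The decomposition is carried out
one summand at a time: `exists_isSplitChain` produces a string together with linear functionals
that form a retraction onto it, and `LiftsStrings.exists_section` constructs the maps by induction
on the total dimension, splitting off one string in each step.

The rank equalities for single equations follow from solvability, but they are not needed for
the converse, being up to the order of blocks the coupled ones with `m = n`.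
-/

open Matrix
open scoped Quaternion

/-! ### Factoring linear maps over a division ring -/

section Factor

variable {K R V Q : Type*} [DivisionRing K] [AddCommGroup R] [Module K R] [AddCommGroup V]
  [Module K V] [AddCommGroup Q] [Module K Q]

theorem LinearMap.exists_apply_eq_of_ker_le_ker (g : R →ₗ[K] V) (h : R →ₗ[K] Q)
    (hgh : ∀ x, g x = 0 → h x = 0) : ∃ η : V →ₗ[K] Q, ∀ x, η (g x) = h x := by
  obtain ⟨r, hr⟩ := ((LinearMap.ker g).liftQ g le_rfl).exists_leftInverse_of_injective
    (Submodule.ker_liftQ_eq_bot _ _ _ le_rfl)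
  refine ⟨((LinearMap.ker g).liftQ h fun x hx => hgh x hx) ∘ₗ r, fun x => ?_⟩
  have := LinearMap.congr_fun hr ((LinearMap.ker g).mkQ x)
  simp only [LinearMap.comp_apply, Submodule.mkQ_apply, Submodule.liftQ_apply,
    LinearMap.id_apply] at this
  rw [LinearMap.comp_apply, this]
  exact Submodule.liftQ_apply _ _ _

theorem LinearMap.exists_apply_eq_of_range_le_range (g : R →ₗ[K] V) (h : Q →ₗ[K] V)
    (hgh : ∀ y, ∃ x, g x = h y) : ∃ η : Q →ₗ[K] R, ∀ y, g (η y) = h y := by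
  obtain ⟨η, hη⟩ := Module.projective_lifting_property g.rangeRestrict
    (h.codRestrict (LinearMap.range g) fun y => hgh y) g.surjective_rangeRestrict
  exact ⟨η, fun y => congrArg Subtype.val (LinearMap.congr_fun hη y)⟩

theorem Submodule.exists_functional_eq_one {L : Submodule K V} {y : V} (hy : y ∉ L) :
    ∃ φ : V →ₗ[K] K, φ y = 1 ∧ ∀ x ∈ L, φ x = 0 := by
  obtain ⟨φ, h₀, h₁⟩ := LinearMap.exists_extend_of_notMem (0 : L →ₗ[K] K) hy 1
  exact ⟨φ, h₁, fun x hx => by simpa using LinearMap.congr_fun h₀ ⟨x, hx⟩⟩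

/-- A functional on `M` can be transported along `c` to a functional on `V` that vanishes on `L`,
as soon as it vanishes on the part of `M` that `c` sends into `L`. -/
theorem LinearMap.exists_functional_extension (c : R →ₗ[K] V) (M : Submodule K R)
    (L : Submodule K V) (ψ : R →ₗ[K] K) (h : ∀ x ∈ M, c x ∈ L → ψ x = 0) :
    ∃ φ : V →ₗ[K] K, (∀ y ∈ L, φ y = 0) ∧ ∀ x ∈ M, φ (c x) = ψ x := by
  obtain ⟨η, hη⟩ := LinearMap.exists_apply_eq_of_ker_le_ker (L.mkQ ∘ₗ c ∘ₗ M.subtype)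
    (ψ ∘ₗ M.subtype) fun x hx => h x x.2 <| by simpa using hx
  refine ⟨η ∘ₗ L.mkQ, fun y hy => ?_, fun x hx => hη ⟨x, hx⟩⟩
  rw [LinearMap.comp_apply, Submodule.mkQ_apply, (Submodule.Quotient.mk_eq_zero L).2 hy, map_zero]

end Factor

/-! ### Splitting an interval off a zigzag of vector spaces -/

section Zigzag

variable {K : Type*} [DivisionRing K] {R V T Q : ℕ → Type*}
  [∀ i, AddCommGroup (R i)] [∀ i, Module K (R i)] [∀ i, AddCommGroup (V i)] [∀ i, Module K (V i)]
  [∀ i, AddCommGroup (T i)] [∀ i, Module K (T i)] [∀ i, AddCommGroup (Q i)] [∀ i, Module K (Q i)]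

/-- A string `u j, …, u n` in the subrepresentation `M` of the zigzag formed by
`c i : R i → V i` and `f i : R i → V (i + 1)`, together with functionals `ψ i` on `R i` and `φ i`
on `V i` that form a retraction of `M` onto the string. The right end is closed (`f n (u n) = 0`,
the string ends at `R n`) or open (it ends at `V (n + 1)`) according to the proposition `o`; the
index `b` marks the end of the zigzag. Nothing is required at `V j`, so that the left end remains
to be dealt with, and all data with an index outside the string are irrelevant. -/
structure IsSplitChain (c : ∀ i, R i →ₗ[K] V i) (f : ∀ i, R i →ₗ[K] V (i + 1))
    (M : ∀ i, Submodule K (R i)) (b j n : ℕ) (o : Prop) (u : ∀ i, R i)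
    (ψ : ∀ i, R i →ₗ[K] K) (φ : ∀ i, V i →ₗ[K] K) : Prop where
  mem : ∀ i, j ≤ i → i ≤ n → u i ∈ M i
  one : ∀ i, j ≤ i → i ≤ n → ψ i (u i) = 1
  link : ∀ i, j ≤ i → i < n → f i (u i) = c (i + 1) (u (i + 1))
  left : ∀ i, j < i → i ≤ n → ∀ x ∈ M i, φ i (c i x) = ψ i x
  right : ∀ i, j ≤ i → i < n → ∀ x ∈ M i, φ (i + 1) (f i x) = ψ i x
  closed_right : ¬ o → f n (u n) = 0
  open_right : o → ∀ x ∈ M n, φ (n + 1) (f n x) = ψ n x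
  open_next : o → n + 1 < b → ∀ x ∈ M (n + 1), φ (n + 1) (c (n + 1) x) = 0

/-- If `L < H ≤ M j`, then some split string starts with an element of `H` and its retraction
vanishes on `L`. If such a string cannot be stopped at `R j` or at `V (j + 1)`, then `L` and `H` are
pushed forward along `f j` and pulled back along `c (j + 1)`, where they are still distinct, and
the string is continued to the right. Keeping track of `L` ensures that the functional found at
`R (j + 1)` descends to `V (j + 1)`. -/
theorem exists_isSplitChain (c : ∀ i, R i →ₗ[K] V i) (f : ∀ i, R i →ₗ[K] V (i + 1))
    (M : ∀ i, Submodule K (R i)) (b j : ℕ) (hj : j < b)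
    (L H : Submodule K (R j)) (hHM : H ≤ M j) (hLH : L < H) :
    ∃ n o u ψ φ, j ≤ n ∧ n < b ∧ IsSplitChain c f M b j n o u ψ φ ∧ u j ∈ H ∧
      ∀ x ∈ L, ψ j x = 0 := by
  induction hl : b - j using Nat.strong_induction_on generalizing j with
  | _ l ih =>
  -- The string can be closed at `R j`.
  by_cases hclosed : ∃ w ∈ H, f j w = 0 ∧ w ∉ L
  · obtain ⟨w, hwH, hfw, hwL⟩ := hclosed
    obtain ⟨ψ, hψw, hψL⟩ := Submodule.exists_functional_eq_one hwL
    refine ⟨j, False, Pi.single j w, Pi.single j ψ, 0, le_rfl, hj, ?_, by simpa, by simpa⟩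
    refine ⟨fun i h₁ h₂ => ?_, fun i h₁ h₂ => ?_, by omega, by omega, by omega, by simpa,
      False.elim, False.elim⟩
    · obtain rfl : i = j := by omega
      simpa using hHM hwH
    · obtain rfl : i = j := by omega
      simpa
  push Not at hclosed
  -- The string can end at `V (j + 1)`: its last element is not reached from the right, modulo `L`.
  by_cases hopen : ∃ w ∈ H, f j w ∉
      L.map (f j) ⊔ (if j + 1 < b then (M (j + 1)).map (c (j + 1)) else ⊥)
  · obtain ⟨w, hwH, hw⟩ := hopen
    obtain ⟨φ, hφw, hφ⟩ := Submodule.exists_functional_eq_one hw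
    refine ⟨j, True, Pi.single j w, Pi.single j (φ ∘ₗ f j), Pi.single (j + 1) φ, le_rfl, hj, ?_,
      by simpa, fun x hx => ?_⟩
    · refine ⟨fun i h₁ h₂ => ?_, fun i h₁ h₂ => ?_, by omega, by omega, by omega, by simp,
        by simp, fun _ hb x hx => ?_⟩
      · obtain rfl : i = j := by omega
        simpa using hHM hwH
      · obtain rfl : i = j := by omega
        simpa
      · rw [Pi.single_eq_same]
        refine hφ _ (Submodule.mem_sup_right ?_)
        rw [if_pos hb]
        exact Submodule.mem_map_of_mem hx
    · rw [Pi.single_eq_same]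
      exact hφ _ (Submodule.mem_sup_left (Submodule.mem_map_of_mem hx))
  push Not at hopen
  obtain ⟨w₀, hw₀H, hw₀L⟩ := SetLike.exists_of_lt hLH
  have hfw₀ : f j w₀ ∉ L.map (f j) := by
    rintro ⟨v, hvL, hv⟩
    refine hw₀L ?_
    have := hclosed (w₀ - v) (H.sub_mem hw₀H (hLH.le hvL)) (by simp [hv])
    simpa using L.add_mem this hvL
  have hjb : j + 1 < b := by
    by_contra hjb
    have := hopen w₀ hw₀H
    rw [if_neg hjb, sup_bot_eq] at this
    exact hfw₀ this
  simp only [if_pos hjb] at hopen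
  obtain ⟨n, o, u, ψ, φ, hjn, hnb, hs, hu, hψ⟩ := ih (b - (j + 1)) (by omega) (j + 1) hjb
    (M (j + 1) ⊓ (L.map (f j)).comap (c (j + 1))) (M (j + 1) ⊓ (H.map (f j)).comap (c (j + 1)))
    inf_le_left (by
      refine lt_of_le_of_ne
        (inf_le_inf_left _ (Submodule.comap_mono (Submodule.map_mono hLH.le))) fun heq => ?_
      obtain ⟨y, hy, z, hz, hyz⟩ := Submodule.mem_sup.1 (hopen w₀ hw₀H)
      obtain ⟨x, hxM, rfl⟩ := hz
      have hyH := Submodule.map_mono (f := f j) hLH.le hy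
      have hx : x ∈ M (j + 1) ⊓ (H.map (f j)).comap (c (j + 1)) := by
        refine ⟨hxM, ?_⟩
        rw [SetLike.mem_coe, Submodule.mem_comap, eq_sub_of_add_eq' hyz]
        exact Submodule.sub_mem _ (Submodule.mem_map_of_mem hw₀H) hyH
      rw [← heq] at hx
      exact hfw₀ (hyz ▸ Submodule.add_mem _ hy hx.2)) rfl
  obtain ⟨w, hwH, hw⟩ := hu.2
  obtain ⟨φ₀, hφ₀L, hφ₀⟩ := LinearMap.exists_functional_extension (c (j + 1)) (M (j + 1))
    (L.map (f j)) (ψ (j + 1)) fun x hx hx' => hψ x ⟨hx, hx'⟩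
  refine ⟨n, o, Function.update u j w, Function.update ψ j (φ₀ ∘ₗ f j),
    Function.update φ (j + 1) φ₀, by omega, hnb, ?_, by simpa, fun x hx => ?_⟩
  · have hne : ∀ i, j < i → i ≠ j := fun i h => by omega
    refine ⟨fun i h₁ h₂ => ?_, fun i h₁ h₂ => ?_, fun i h₁ h₂ => ?_, fun i h₁ h₂ x hx => ?_,
      fun i h₁ h₂ x hx => ?_, fun ho => ?_, fun ho x hx => ?_, fun ho hb x hx => ?_⟩
    · rcases h₁.eq_or_lt with rfl | h₁
      · simpa using hHM hwH
      · simpa [hne i h₁] using hs.mem i h₁ h₂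
    · rcases h₁.eq_or_lt with rfl | h₁
      · simp only [Function.update_self, LinearMap.comp_apply, hw]
        rw [hφ₀ _ hu.1]
        exact hs.one _ le_rfl hjn
      · simpa [hne i h₁] using hs.one i h₁ h₂
    · rcases h₁.eq_or_lt with rfl | h₁
      · simpa using hw
      · simpa [hne i h₁, hne (i + 1) (by omega)] using hs.link i h₁ h₂
    · obtain rfl | h₁ : i = j + 1 ∨ j + 1 < i := by omega
      · simpa using hφ₀ x hx
      · simpa [hne i (by omega), h₁.ne'] using hs.left i h₁ h₂ x hx
    · rcases h₁.eq_or_lt with rfl | h₁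
      · simp
      · simpa [hne i h₁, (show i + 1 ≠ j + 1 by omega)] using hs.right i h₁ h₂ x hx
    · simpa [hne n (by omega)] using hs.closed_right ho
    · simpa [hne n (by omega), (show n + 1 ≠ j + 1 by omega)] using hs.open_right ho x hx
    · rw [Function.update_of_ne (show n + 1 ≠ j + 1 by omega)]
      exact hs.open_next ho hb x hx
  · simpa using hφ₀L _ (Submodule.mem_map_of_mem hx)

/-- Every string `u m, …, u n` in `M` with `a ≤ m ≤ n < b` admits a solution `z` of the equations
`d i (z i) + g i (z (i + 1)) = e i (u i)` along the string. The propositions `l` and `o` say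
whether the left end and the right end are open; at a closed end, where the string is annihilated
by `c m` or by `f n`, the solution has to vanish. -/
def LiftsStrings (c : ∀ i, R i →ₗ[K] V i) (f : ∀ i, R i →ₗ[K] V (i + 1))
    (d : ∀ i, T i →ₗ[K] Q i) (g : ∀ i, T (i + 1) →ₗ[K] Q i) (e : ∀ i, R i →ₗ[K] Q i)
    (a b : ℕ) (M : ∀ i, Submodule K (R i)) : Prop :=
  ∀ m n, a ≤ m → m ≤ n → n < b → ∀ u : ∀ i, R i, (∀ i, m ≤ i → i ≤ n → u i ∈ M i) →
    (∀ i, m ≤ i → i < n → f i (u i) = c (i + 1) (u (i + 1))) →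
    ∀ l o : Prop, (¬ l → c m (u m) = 0) → (¬ o → f n (u n) = 0) →
      ∃ z : ∀ i, T i, (¬ l → z m = 0) ∧ (¬ o → z (n + 1) = 0) ∧
        ∀ i, m ≤ i → i ≤ n → d i (z i) + g i (z (i + 1)) = e i (u i)

/-- A nonzero subrepresentation `M` in which strings lift contains a string that splits off,
together with a lift `z` of it. Here `ψ` and `φ` are extended by zero outside the string, and `σ`
is the string at the vertices `V i`. -/
theorem LiftsStrings.exists_split {c : ∀ i, R i →ₗ[K] V i} {f : ∀ i, R i →ₗ[K] V (i + 1)}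
    {d : ∀ i, T i →ₗ[K] Q i} {g : ∀ i, T (i + 1) →ₗ[K] Q i} {e : ∀ i, R i →ₗ[K] Q i}
    {a b : ℕ} {M : ∀ i, Submodule K (R i)} (h : LiftsStrings c f d g e a b M)
    (hM : ∃ i, a ≤ i ∧ i < b ∧ M i ≠ ⊥) :
    ∃ (u : ∀ i, R i) (ψ : ∀ i, R i →ₗ[K] K) (σ : ∀ i, V i) (φ : ∀ i, V i →ₗ[K] K) (z : ∀ i, T i),
      (∃ i, a ≤ i ∧ i < b ∧ u i ∈ M i ∧ ψ i (u i) = 1) ∧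
      ∀ i, a ≤ i → i < b → ∀ x ∈ M i,
        ψ i x • u i ∈ M i ∧ ψ i (ψ i x • u i) = ψ i x ∧
        φ i (c i x) • σ i = ψ i x • c i (u i) ∧ φ i (c i x) • z i = ψ i x • z i ∧
        φ (i + 1) (f i x) • σ (i + 1) = ψ i x • f i (u i) ∧
        φ (i + 1) (f i x) • z (i + 1) = ψ i x • z (i + 1) ∧
        ψ i x • (d i (z i) + g i (z (i + 1))) = ψ i x • e i (u i) := by
  classical
  -- Starting where `M` starts, there is no condition on `φ m` coming from `R (m - 1)`.
  obtain ⟨m, ⟨ham, hmb, hm⟩, hmin⟩ : ∃ m, (a ≤ m ∧ m < b ∧ M m ≠ ⊥) ∧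
      ∀ i, a ≤ i → i < m → M i = ⊥ := by
    refine ⟨Nat.find hM, Nat.find_spec hM, fun i hai hi => ?_⟩
    have := Nat.find_min hM hi
    by_contra hne
    exact this ⟨hai, hi.trans (Nat.find_spec hM).2.1, hne⟩
  -- If `c m` does not vanish on `M m`, choosing `ψ m` to vanish on its kernel makes `ψ m` descend
  -- to `V m`, and the left end is open; otherwise every string from `R m` is closed on the left.
  obtain ⟨l, n, o, u, ψ, φ, hmn, hnb, hs, hl, hnl⟩ : ∃ l n o u ψ φ, m ≤ n ∧ n < b ∧
      IsSplitChain c f M b m n o u ψ φ ∧ (l → ∀ x ∈ M m, φ m (c m x) = ψ m x) ∧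
      (¬ l → c m (u m) = 0) := by
    by_cases hc : ∃ x ∈ M m, c m x ≠ 0
    · obtain ⟨x₀, hx₀, hcx₀⟩ := hc
      obtain ⟨n, o, u, ψ, φ, hmn, hnb, hs, -, hψ⟩ := exists_isSplitChain c f M b m hmb
        (M m ⊓ LinearMap.ker (c m)) (M m) le_rfl
        (lt_of_le_of_ne inf_le_left fun heq => hcx₀ (inf_eq_left.1 heq hx₀))
      obtain ⟨φ₀, -, hφ₀⟩ := LinearMap.exists_functional_extension (c m) (M m) ⊥ (ψ m)
        fun x hx hx' => hψ x ⟨hx, hx'⟩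
      refine ⟨True, n, o, u, ψ, Function.update φ m φ₀, hmn, hnb, ?_, by simpa, by simp⟩
      have hne : ∀ i, m < i → i ≠ m := fun i h => by omega
      exact ⟨hs.mem, hs.one, hs.link,
        fun i h₁ h₂ => by simpa [hne i h₁] using hs.left i h₁ h₂,
        fun i h₁ h₂ => by simpa [hne (i + 1) (by omega)] using hs.right i h₁ h₂,
        hs.closed_right, fun ho => by simpa [hne (n + 1) (by omega)] using hs.open_right ho,
        fun ho hb => by simpa [hne (n + 1) (by omega)] using hs.open_next ho hb⟩
    · push Not at hc
      obtain ⟨n, o, u, ψ, φ, hmn, hnb, hs, -, -⟩ := exists_isSplitChain c f M b m hmb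
        ⊥ (M m) le_rfl (bot_lt_iff_ne_bot.2 hm)
      exact ⟨False, n, o, u, ψ, φ, hmn, hnb, hs, False.elim,
        fun _ => hc _ (hs.mem m le_rfl hmn)⟩
  obtain ⟨z, hzl, hzo, hz⟩ := h m n ham hmn hnb u hs.mem hs.link l o hnl hs.closed_right
  refine ⟨u, fun i => if m ≤ i ∧ i ≤ n then ψ i else 0,
    Function.update (fun i => c i (u i)) (n + 1) (f n (u n)),
    fun i => if (m < i ∨ m = i ∧ l) ∧ (i ≤ n ∨ i = n + 1 ∧ o) then φ i else 0, z,
    ⟨m, ham, hmb, hs.mem m le_rfl hmn, by simpa [hmn] using hs.one m le_rfl hmn⟩,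
    fun i hai hib x hx => ?_⟩
  rcases lt_or_ge i m with him | hmi
  · have hx0 : x = 0 := by simpa [hmin i hai him] using hx
    subst hx0
    simp
  rcases lt_or_ge n i with hni | hin
  · have h₁ : ¬ (m ≤ i ∧ i ≤ n) := by omega
    have h₂ : ¬ ((m < i + 1 ∨ m = i + 1 ∧ l) ∧ (i + 1 ≤ n ∨ i + 1 = n + 1 ∧ o)) := by omega
    simp only [if_neg h₁, if_neg h₂, LinearMap.zero_apply, zero_smul, Submodule.zero_mem,
      true_and, and_true]
    have h₃ : (if (m < i ∨ m = i ∧ l) ∧ (i ≤ n ∨ i = n + 1 ∧ o) then φ i else 0) (c i x) = 0 := by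
      split_ifs with hi
      · obtain ⟨rfl, ho⟩ : i = n + 1 ∧ o := by
          rcases hi.2 with hi | hi
          · omega
          · exact hi
        exact hs.open_next ho hib x hx
      · rfl
    rw [h₃]
    simp
  have hψ : m ≤ i ∧ i ≤ n := ⟨hmi, hin⟩
  simp only [if_pos hψ]
  refine ⟨Submodule.smul_mem _ _ (hs.mem i hmi hin), by simp [hs.one i hmi hin], ?_⟩
  have hσ : Function.update (fun i => c i (u i)) (n + 1) (f n (u n)) i = c i (u i) := by
    rw [Function.update_of_ne (by omega)]
  have hσ' : Function.update (fun i => c i (u i)) (n + 1) (f n (u n)) (i + 1) = f i (u i) := by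
    rcases hin.eq_or_lt with rfl | hin
    · simp
    · rw [Function.update_of_ne (by omega), hs.link i hmi hin]
  rw [hσ, hσ', hz i hmi hin, ← and_assoc, ← and_assoc (b := _ • z (i + 1) = _)]
  refine ⟨?_, ?_, rfl⟩
  · by_cases hi : m < i ∨ m = i ∧ l
    · rw [if_pos ⟨hi, Or.inl hin⟩]
      have : φ i (c i x) = ψ i x := by
        rcases hi with hi | ⟨rfl, hi⟩
        · exact hs.left i hi hin x hx
        · exact hl hi x hx
      simp [this]
    · obtain ⟨rfl, hnl'⟩ : m = i ∧ ¬ l := by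
        have : m = i := by by_contra; exact hi (Or.inl (by omega))
        exact ⟨this, fun h => hi (Or.inr ⟨this, h⟩)⟩
      rw [if_neg (fun h => hi h.1), hnl hnl', hzl hnl']
      simp
  · by_cases hi : i + 1 ≤ n ∨ i + 1 = n + 1 ∧ o
    · rw [if_pos ⟨Or.inl (by omega), hi⟩]
      have : φ (i + 1) (f i x) = ψ i x := by
        rcases hi with hi | ⟨hi, ho⟩
        · exact hs.right i hmi hi x hx
        · obtain rfl : i = n := by omega
          exact hs.open_right ho x hx
      simp [this]
    · obtain ⟨rfl, hno⟩ : i = n ∧ ¬ o := by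
        have : i = n := by by_contra; exact hi (Or.inl (by omega))
        exact ⟨this, fun h => hi (Or.inr ⟨by omega, h⟩)⟩
      rw [if_neg (fun h => hi h.2), hs.closed_right hno, hzo hno]
      simp

/-- If strings lift, then the lifts can be chosen linearly: there are linear maps `ζ i : V i → T i`
that solve the equations on all of `M`. -/
theorem LiftsStrings.exists_section [∀ i, Module.Finite K (R i)]
    {c : ∀ i, R i →ₗ[K] V i} {f : ∀ i, R i →ₗ[K] V (i + 1)}
    {d : ∀ i, T i →ₗ[K] Q i} {g : ∀ i, T (i + 1) →ₗ[K] Q i} {e : ∀ i, R i →ₗ[K] Q i}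
    {a b : ℕ} {M : ∀ i, Submodule K (R i)} (h : LiftsStrings c f d g e a b M) :
    ∃ ζ : ∀ i, V i →ₗ[K] T i, ∀ i, a ≤ i → i < b → ∀ x ∈ M i,
      d i (ζ i (c i x)) + g i (ζ (i + 1) (f i x)) = e i x := by
  induction hN : ∑ i ∈ Finset.Ico a b, Module.finrank K (M i) using Nat.strong_induction_on
    generalizing M with
  | _ N ih =>
  by_cases hM : ∃ i, a ≤ i ∧ i < b ∧ M i ≠ ⊥
  swap
  · push Not at hM
    refine ⟨0, fun i hai hib x hx => ?_⟩
    have hx0 : x = 0 := by simpa [hM i hai hib] using hx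
    simp [hx0]
  obtain ⟨u, ψ, σ, φ, z, ⟨i₀, hai₀, hib₀, hu₀, hψ₀⟩, hsplit⟩ := h.exists_split hM
  have hlt : M i₀ ⊓ LinearMap.ker (ψ i₀) < M i₀ := by
    refine lt_of_le_of_ne inf_le_left fun heq => ?_
    have := (inf_eq_left.1 heq) hu₀
    rw [LinearMap.mem_ker, hψ₀] at this
    exact one_ne_zero this
  obtain ⟨ζ, hζ⟩ := ih _ (hN ▸ Finset.sum_lt_sum
      (fun i _ => Submodule.finrank_mono (inf_le_left : M i ⊓ LinearMap.ker (ψ i) ≤ M i))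
      ⟨i₀, by simp [hai₀, hib₀], Submodule.finrank_lt_finrank_of_lt hlt⟩)
    (M := fun i => M i ⊓ LinearMap.ker (ψ i))
    (fun m n ham hmn hnb v hv => h m n ham hmn hnb v fun i h₁ h₂ => (hv i h₁ h₂).1) rfl
  -- Lift the component along the string by `z` and the remaining component by `ζ`.
  refine ⟨fun i => ζ i ∘ₗ (LinearMap.id - LinearMap.toSpanSingleton K (V i) (σ i) ∘ₗ φ i) +
    LinearMap.toSpanSingleton K (T i) (z i) ∘ₗ φ i, fun i hai hib x hx => ?_⟩
  obtain ⟨h₁, h₂, h₃, h₄, h₅, h₆, h₇⟩ := hsplit i hai hib x hx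
  have := hζ i hai hib (x - ψ i x • u i)
    ⟨Submodule.sub_mem _ hx h₁, by rw [SetLike.mem_coe, LinearMap.mem_ker, map_sub, h₂, sub_self]⟩
  simp only [LinearMap.add_apply, LinearMap.comp_apply, LinearMap.sub_apply, LinearMap.id_apply,
    LinearMap.toSpanSingleton_apply, h₃, h₄, h₅, h₆]
  simp only [map_sub, map_smul, map_add, smul_add] at this h₇ ⊢
  rw [← sub_add_cancel (e i x) (ψ i x • e i (u i)), ← this, ← h₇]
  abel

end Zigzag

/-! ### Ranks of quaternion matrices and linear maps of columns -/

section Rank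

instance Quaternion.finite_mulOpposite : Module.Finite ℍ[ℝ]ᵐᵒᵖ ℍ[ℝ] :=
  ⟨⟨{1}, by
    rw [Finset.coe_singleton, eq_top_iff]
    exact fun x _ => Submodule.mem_span_singleton.2 ⟨MulOpposite.op x, by simp⟩⟩⟩

/-- Multiplication of columns by a quaternion matrix, as a map of right vector spaces. -/
noncomputable def colMap {m n : Type*} [Fintype n] (A : Matrix m n ℍ[ℝ]) :
    (n → ℍ[ℝ]) →ₗ[ℍ[ℝ]ᵐᵒᵖ] (m → ℍ[ℝ]) :=
  Matrix.mulVecBilin ℍ[ℝ] ℍ[ℝ]ᵐᵒᵖ A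

@[simp]
theorem colMap_apply {m n : Type*} [Fintype n] (A : Matrix m n ℍ[ℝ]) (x : n → ℍ[ℝ]) :
    colMap A x = A *ᵥ x := rfl

theorem exists_colMap_eq {m n : Type*} [Fintype n] (L : (n → ℍ[ℝ]) →ₗ[ℍ[ℝ]ᵐᵒᵖ] (m → ℍ[ℝ])) :
    ∃ A : Matrix m n ℍ[ℝ], ∀ x, A *ᵥ x = L x := by
  classical
  refine ⟨Matrix.of fun i j => L (Pi.single j 1) i, fun x => ?_⟩
  have hx : x = ∑ j, MulOpposite.op (x j) • (Pi.single j 1 : n → ℍ[ℝ]) := by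
    ext1 i
    simp [Pi.single_apply]
  conv_rhs => rw [hx]
  rw [map_sum, Matrix.mulVec_eq_sum]
  refine Finset.sum_congr rfl fun j _ => ?_
  rw [map_smul]
  rfl

theorem range_colMap {m n : Type*} [Fintype n] (A : Matrix m n ℍ[ℝ]) :
    LinearMap.range (colMap A) = Submodule.span ℍ[ℝ]ᵐᵒᵖ (Set.range A.col) := by
  classical
  refine le_antisymm ?_ (Submodule.span_le.2 ?_)
  · rintro _ ⟨x, rfl⟩
    rw [colMap_apply, Matrix.mulVec_eq_sum]
    exact Submodule.sum_mem _ fun j _ =>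
      Submodule.smul_mem _ _ (Submodule.subset_span ⟨j, rfl⟩)
  · rintro _ ⟨j, rfl⟩
    exact ⟨Pi.single j 1, by simp⟩

theorem quatRank_eq_finrank_range {m n : Type*} [Fintype n] (A : Matrix m n ℍ[ℝ]) :
    quatRank A = Module.finrank ℍ[ℝ]ᵐᵒᵖ (LinearMap.range (colMap A)) := by
  rw [range_colMap, quatRank]

theorem Submodule.finrank_map_add_finrank_inf_ker {K V W : Type*} [DivisionRing K]
    [AddCommGroup V] [Module K V] [AddCommGroup W] [Module K W] [Module.Finite K V]
    (f : V →ₗ[K] W) (p : Submodule K V) :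
    Module.finrank K (p.map f) + Module.finrank K (p ⊓ LinearMap.ker f : Submodule K V) =
      Module.finrank K p := by
  rw [← LinearMap.finrank_range_add_finrank_ker (f.domRestrict p), LinearMap.range_domRestrict,
    LinearMap.ker_domRestrict, ← Submodule.finrank_map_subtype_eq p, Submodule.map_comap_subtype]

/-- The rank of `(E, M; N, 0)` is the rank of `N` plus the dimension of the space of all
`E x + M y` with `N x = 0`, and this space contains the column space of `M`. -/
theorem quatRank_fromBlocks_zero_iff {m n c r : Type*} [Fintype m] [Fintype n] [Fintype c]
    [Fintype r] (E : Matrix m n ℍ[ℝ]) (M : Matrix m c ℍ[ℝ]) (N : Matrix r n ℍ[ℝ]) :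
    quatRank (fromBlocks E M N 0) = quatRank M + quatRank N ↔
      ∀ x, N *ᵥ x = 0 → ∃ y, M *ᵥ y = E *ᵥ x := by
  let lower : (m ⊕ r → ℍ[ℝ]) →ₗ[ℍ[ℝ]ᵐᵒᵖ] (r → ℍ[ℝ]) := LinearMap.funLeft _ _ Sum.inr
  let upper : (m ⊕ r → ℍ[ℝ]) →ₗ[ℍ[ℝ]ᵐᵒᵖ] (m → ℍ[ℝ]) := LinearMap.funLeft _ _ Sum.inl
  let W := LinearMap.range (colMap (fromBlocks E M N 0))
  have hlower : W.map lower = LinearMap.range (colMap N) := by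
    ext v
    constructor
    · rintro ⟨_, ⟨x, rfl⟩, rfl⟩
      exact ⟨x ∘ Sum.inl, by ext1 i; simp [lower, LinearMap.funLeft, fromBlocks_mulVec]⟩
    · rintro ⟨x, rfl⟩
      refine ⟨_, ⟨Sum.elim x 0, rfl⟩, ?_⟩
      ext1 i; simp [lower, LinearMap.funLeft, fromBlocks_mulVec]
  have hinj : Disjoint (W ⊓ LinearMap.ker lower) (LinearMap.ker upper) := by
    rw [Submodule.disjoint_def]
    rintro x ⟨-, hx⟩ hx'
    ext1 i
    rcases i with i | i
    · exact congrFun hx' i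
    · exact congrFun hx i
  have hupper : Module.finrank ℍ[ℝ]ᵐᵒᵖ ((W ⊓ LinearMap.ker lower).map upper) =
      Module.finrank ℍ[ℝ]ᵐᵒᵖ (W ⊓ LinearMap.ker lower : Submodule ℍ[ℝ]ᵐᵒᵖ (m ⊕ r → ℍ[ℝ])) := by
    rw [← Submodule.finrank_map_add_finrank_inf_ker upper, hinj.eq_bot, finrank_bot, add_zero]
  have hmem : ∀ v, v ∈ (W ⊓ LinearMap.ker lower).map upper ↔
      ∃ x y, N *ᵥ x = 0 ∧ E *ᵥ x + M *ᵥ y = v := by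
    intro v
    constructor
    · rintro ⟨_, ⟨⟨x, rfl⟩, hx⟩, rfl⟩
      refine ⟨x ∘ Sum.inl, x ∘ Sum.inr, ?_, ?_⟩
      · ext1 i
        simpa [lower, LinearMap.funLeft, fromBlocks_mulVec] using congrFun hx i
      · ext1 i
        simp [upper, LinearMap.funLeft, fromBlocks_mulVec]
    · rintro ⟨x, y, hx, rfl⟩
      refine ⟨_, ⟨⟨Sum.elim x y, rfl⟩, ?_⟩, ?_⟩
      · ext1 i
        simpa [lower, LinearMap.funLeft, fromBlocks_mulVec] using congrFun hx i
      · ext1 i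
        simp [upper, LinearMap.funLeft, fromBlocks_mulVec]
  have hle : LinearMap.range (colMap M) ≤ (W ⊓ LinearMap.ker lower).map upper := by
    rintro _ ⟨y, rfl⟩
    exact (hmem _).2 ⟨0, y, by simp, by simp⟩
  have hrank : quatRank (fromBlocks E M N 0) = quatRank N +
      Module.finrank ℍ[ℝ]ᵐᵒᵖ ((W ⊓ LinearMap.ker lower).map upper) := by
    rw [hupper, quatRank_eq_finrank_range N, ← hlower,
      Submodule.finrank_map_add_finrank_inf_ker, quatRank_eq_finrank_range]
  rw [hrank, add_comm (quatRank M), add_right_inj, quatRank_eq_finrank_range M]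
  constructor
  · intro h x hx
    have heq := Submodule.eq_of_le_of_finrank_eq hle h.symm
    exact (heq ▸ (hmem (E *ᵥ x)).2 ⟨x, 0, hx, by simp⟩ : E *ᵥ x ∈ LinearMap.range (colMap M))
  · intro h
    refine congrArg (fun p : Submodule ℍ[ℝ]ᵐᵒᵖ (m → ℍ[ℝ]) => Module.finrank ℍ[ℝ]ᵐᵒᵖ p)
      (le_antisymm (fun v hv => ?_) hle)
    obtain ⟨x, y, hx, rfl⟩ := (hmem v).1 hv
    obtain ⟨y', hy'⟩ := h x hx
    exact ⟨y' + y, by rw [colMap_apply, mulVec_add, hy']⟩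

/-- If `E` maps the kernel of `B` into the column space of `A`, then `A X + Y B = E` is solvable. -/
theorem exists_mul_add_mul_eq {m n c r : Type*} [Fintype m] [Fintype n] [Fintype c] [Fintype r]
    (E : Matrix m n ℍ[ℝ]) (A : Matrix m c ℍ[ℝ]) (B : Matrix r n ℍ[ℝ])
    (h : ∀ x, B *ᵥ x = 0 → ∃ y, A *ᵥ y = E *ᵥ x) :
    ∃ (X : Matrix c n ℍ[ℝ]) (Y : Matrix m r ℍ[ℝ]), A * X + Y * B = E := by
  obtain ⟨η, hη⟩ := LinearMap.exists_apply_eq_of_ker_le_ker (colMap B)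
    ((LinearMap.range (colMap A)).mkQ ∘ₗ colMap E) fun x hx => by
      simpa using h x hx
  obtain ⟨υ, hυ⟩ := LinearMap.exists_apply_eq_of_range_le_range
    (LinearMap.range (colMap A)).mkQ η fun y => Submodule.mkQ_surjective _ _
  obtain ⟨Y, hY⟩ := exists_colMap_eq υ
  obtain ⟨ξ, hξ⟩ := LinearMap.exists_apply_eq_of_range_le_range (colMap A) (colMap (E - Y * B))
    fun x => by
      have : (LinearMap.range (colMap A)).mkQ (E *ᵥ x) =
          (LinearMap.range (colMap A)).mkQ (Y *ᵥ (B *ᵥ x)) := by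
        rw [hY, hυ]
        exact (hη x).symm
      rw [Submodule.mkQ_apply, Submodule.mkQ_apply, Submodule.Quotient.eq] at this
      simpa [sub_mulVec, mulVec_mulVec] using this
  obtain ⟨X, hX⟩ := exists_colMap_eq ξ
  refine ⟨X, Y, mulVec_injective (funext fun x => ?_)⟩
  have := hξ x
  rw [← hX, colMap_apply, colMap_apply, sub_mulVec] at this
  rw [add_mulVec, ← mulVec_mulVec, this, sub_add_cancel]

end Rank

/-! ### The coupled rank conditions in terms of columns -/

section Blocks

theorem sigma_mulVec {r : Type*} {J : Finset ℕ} {s : ℕ → ℕ}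
    (A : Matrix r (Σ j : J, Fin (s j)) ℍ[ℝ]) (y : ∀ j, Fin (s j) → ℍ[ℝ]) (i : r) :
    (A *ᵥ fun c => y c.1 c.2) i = ∑ j : J, ∑ t, A i ⟨j, t⟩ * y j t := by
  simp [mulVec, dotProduct, Fintype.sum_sigma]

/-- Block columns indexed by `J` are restrictions of families indexed by all natural numbers; this
avoids subtypes in what follows. -/
theorem exists_eq_sigma {J : Finset ℕ} {s : ℕ → ℕ} (v : (Σ j : J, Fin (s j)) → ℍ[ℝ]) :
    ∃ y : ∀ j, Fin (s j) → ℍ[ℝ], v = fun c => y c.1 c.2 := by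
  refine ⟨fun j t => if h : j ∈ J then v ⟨⟨j, h⟩, t⟩ else 0, ?_⟩
  ext1 ⟨⟨j, hj⟩, t⟩
  simp [hj]

theorem blockDiagonal'_mulVec {J : Finset ℕ} {p q : ℕ → ℕ}
    (A : ∀ j : J, Matrix (Fin (p j)) (Fin (q j)) ℍ[ℝ]) (y : ∀ j, Fin (q j) → ℍ[ℝ]) (j : J)
    (t : Fin (p j)) :
    (blockDiagonal' A *ᵥ fun c => y c.1 c.2) ⟨j, t⟩ = (A j *ᵥ y j) t := by
  rw [sigma_mulVec, Finset.sum_eq_single j]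
  · simp [blockDiagonal'_apply, mulVec, dotProduct]
  · intro j' _ hj'
    simp [blockDiagonal'_apply_ne _ _ _ hj'.symm]
  · simp

end Blocks

namespace SylvesterData

variable (S : SylvesterData)

theorem cfBlock_mulVec (i j : ℕ) (y : ∀ j, Fin (S.s j) → ℍ[ℝ]) :
    S.cfBlock i j *ᵥ y j =
      (if i = j then S.C i *ᵥ y i else 0) + (if i + 1 = j then S.F i *ᵥ y (i + 1) else 0) := by
  by_cases h : i = j
  · subst h
    simp [cfBlock]
  · by_cases h' : i + 1 = j
    · subst h'
      simp [cfBlock]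
    · simp [cfBlock, h, h', Ne.symm h, Ne.symm h']

theorem dgBlock_mulVec (j i : ℕ) (x : ∀ i, Fin (S.q i) → ℍ[ℝ]) :
    S.dgBlock (j + 1) i *ᵥ x i =
      (if j + 1 = i then S.D (j + 1) *ᵥ x (j + 1) else 0) +
        (if j = i then S.G j *ᵥ x j else 0) := by
  by_cases h : j + 1 = i
  · subst h
    simp [dgBlock]
  · by_cases h' : j = i
    · subst h'
      simp [dgBlock]
    · simp [dgBlock, h, h']

theorem acfMatrix_mulVec (m n : ℕ) (J : Finset ℕ) (y : ∀ j, Fin (S.s j) → ℍ[ℝ])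
    (w : ∀ i, Fin (S.a i) → ℍ[ℝ]) (i : Finset.Icc m n) (t : Fin (S.p i)) :
    (S.acfMatrix m n J *ᵥ Sum.elim (fun c => y c.1 c.2) (fun c => w c.1 c.2)) ⟨i, t⟩ =
      ((if (i : ℕ) ∈ J then S.C i *ᵥ y i else 0) +
        (if (i : ℕ) + 1 ∈ J then S.F i *ᵥ y (i + 1) else 0) + S.A i *ᵥ w i) t := by
  have h : ∑ j ∈ J, S.cfBlock i j *ᵥ y j = (if (i : ℕ) ∈ J then S.C i *ᵥ y i else 0) +
        (if (i : ℕ) + 1 ∈ J then S.F i *ᵥ y (i + 1) else 0) := by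
    simp_rw [cfBlock_mulVec, Finset.sum_add_distrib, Finset.sum_ite_eq]
  rw [← h, acfMatrix, fromCols_mulVec, Pi.add_apply, Pi.add_apply]
  congr 1
  · rw [Sum.elim_comp_inl, sigma_mulVec, Finset.sum_apply, ← Finset.sum_coe_sort J]
    rfl
  · rw [Sum.elim_comp_inr]
    exact blockDiagonal'_mulVec (fun i : Finset.Icc m n => S.A i) w i t

/-- The block rows are indexed by `j + 1` because the blocks `G j` sit there; hence `0 ∉ J`. -/
theorem bdgMatrix_mulVec_eq_zero_iff (m n : ℕ) (J : Finset ℕ) (hJ : 0 ∉ J)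
    (x : ∀ i, Fin (S.q i) → ℍ[ℝ]) :
    S.bdgMatrix m n J *ᵥ (fun c => x c.1 c.2) = 0 ↔
      (∀ i ∈ Finset.Icc m n, S.B i *ᵥ x i = 0) ∧
      ∀ j, j + 1 ∈ J → (if j + 1 ∈ Finset.Icc m n then S.D (j + 1) *ᵥ x (j + 1) else 0) +
        (if j ∈ Finset.Icc m n then S.G j *ᵥ x j else 0) = 0 := by
  have h : ∀ j, ∑ i ∈ Finset.Icc m n, S.dgBlock (j + 1) i *ᵥ x i =
      (if j + 1 ∈ Finset.Icc m n then S.D (j + 1) *ᵥ x (j + 1) else 0) +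
        (if j ∈ Finset.Icc m n then S.G j *ᵥ x j else 0) := by
    intro j
    simp_rw [dgBlock_mulVec, Finset.sum_add_distrib, Finset.sum_ite_eq]
  have h' : ∀ (j : J) t, ((Matrix.of fun (r : Σ j : J, Fin (S.t j))
      (c : Σ i : Finset.Icc m n, Fin (S.q i)) => S.dgBlock r.1 c.1 r.2 c.2) *ᵥ
        (fun c => x c.1 c.2)) ⟨j, t⟩ = (∑ i ∈ Finset.Icc m n, S.dgBlock j i *ᵥ x i) t := by
    intro j t
    rw [sigma_mulVec, Finset.sum_apply, ← Finset.sum_coe_sort (Finset.Icc m n)]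
    rfl
  have h'' := fun (i : Finset.Icc m n) t => blockDiagonal'_mulVec
    (fun i : Finset.Icc m n => S.B i) x i t
  rw [bdgMatrix, fromRows_mulVec]
  constructor
  · intro hx
    refine ⟨fun i hi => ?_, fun j hj => ?_⟩
    · ext1 t
      exact (h'' ⟨i, hi⟩ t).symm.trans (congrFun hx (Sum.inr ⟨⟨i, hi⟩, t⟩))
    · rw [← h]
      ext1 t
      exact (h' ⟨j + 1, hj⟩ t).symm.trans (congrFun hx (Sum.inl ⟨⟨j + 1, hj⟩, t⟩))
  · rintro ⟨hB, hD⟩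
    ext1 r
    rcases r with ⟨⟨j, hj⟩, t⟩ | ⟨⟨i, hi⟩, t⟩
    · rw [Sum.elim_inl, h']
      obtain _ | j := j
      · exact absurd hj hJ
      · rw [h, hD j hj]
        rfl
    · rw [Sum.elim_inr, h'', hB i hi]
      rfl

theorem eMatrix_mulVec (m n : ℕ) (x : ∀ i, Fin (S.q i) → ℍ[ℝ]) (i : Finset.Icc m n)
    (t : Fin (S.p i)) :
    (S.eMatrix m n *ᵥ fun c => x c.1 c.2) ⟨i, t⟩ =
      ((-1 : ℤ) ^ ((i : ℕ) - m) • (S.E i *ᵥ x i)) t := by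
  rw [eMatrix, blockDiagonal'_mulVec]
  rcases neg_one_pow_eq_or ℤ ((i : ℕ) - m) with h | h
  · have h' : (-1 : ℍ[ℝ]) ^ ((i : ℕ) - m) = 1 := by exact_mod_cast congrArg (Int.cast : ℤ → ℍ[ℝ]) h
    rw [h, h', one_smul, one_smul]
  · have h' : (-1 : ℍ[ℝ]) ^ ((i : ℕ) - m) = -1 := by
      exact_mod_cast congrArg (Int.cast : ℤ → ℍ[ℝ]) h
    rw [h, h', neg_smul, one_smul, neg_smul, one_smul, neg_mulVec]

theorem coupledRankEq_iff (m n : ℕ) (J K : Finset ℕ) (hK : 0 ∉ K) :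
    S.CoupledRankEq m n J K ↔ ∀ x : ∀ i, Fin (S.q i) → ℍ[ℝ],
      (∀ i ∈ Finset.Icc m n, S.B i *ᵥ x i = 0) →
      (∀ j, j + 1 ∈ K → (if j + 1 ∈ Finset.Icc m n then S.D (j + 1) *ᵥ x (j + 1) else 0) +
        (if j ∈ Finset.Icc m n then S.G j *ᵥ x j else 0) = 0) →
      ∃ (y : ∀ j, Fin (S.s j) → ℍ[ℝ]) (w : ∀ i, Fin (S.a i) → ℍ[ℝ]), ∀ i ∈ Finset.Icc m n,
        (if i ∈ J then S.C i *ᵥ y i else 0) + (if i + 1 ∈ J then S.F i *ᵥ y (i + 1) else 0) +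
          S.A i *ᵥ w i = (-1 : ℤ) ^ (i - m) • (S.E i *ᵥ x i) := by
  rw [CoupledRankEq, quatRank_fromBlocks_zero_iff]
  constructor
  · intro h x hB hD
    obtain ⟨v, hv⟩ := h _ ((S.bdgMatrix_mulVec_eq_zero_iff m n K hK x).2 ⟨hB, hD⟩)
    obtain ⟨y, hy⟩ := exists_eq_sigma (v ∘ Sum.inl)
    obtain ⟨w, hw⟩ := exists_eq_sigma (v ∘ Sum.inr)
    refine ⟨y, w, fun i hi => ?_⟩
    ext1 t
    rw [← S.eMatrix_mulVec m n x ⟨i, hi⟩ t, ← S.acfMatrix_mulVec m n J y w ⟨i, hi⟩ t, ← hv, ← hy,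
      ← hw, Sum.elim_comp_inl_inr]
  · intro h v hv
    obtain ⟨x, rfl⟩ := exists_eq_sigma v
    obtain ⟨hB, hD⟩ := (S.bdgMatrix_mulVec_eq_zero_iff m n K hK x).1 hv
    obtain ⟨y, w, hyw⟩ := h x hB hD
    refine ⟨Sum.elim (fun c => y c.1 c.2) (fun c => w c.1 c.2), ?_⟩
    ext1 ⟨i, t⟩
    rw [S.eMatrix_mulVec, S.acfMatrix_mulVec, hyw i i.2]

end SylvesterData

/-! ### Necessity of the rank conditions -/

namespace SylvesterData

variable {S : SylvesterData}

theorem Consistent.coupledRankEq {k : ℕ} (h : S.Consistent k) {m n : ℕ} (hm : 1 ≤ m)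
    (hnk : n ≤ k) {J K : Finset ℕ} (hK₀ : 0 ∉ K)
    (hJ : ∀ i, m < i → i ≤ n → i ∈ J) (hK : ∀ i, m < i → i ≤ n → i ∈ K)
    (hl : m ∈ J ∨ m ∈ K) (hr : n + 1 ∈ J ∨ n + 1 ∈ K) : S.CoupledRankEq m n J K := by
  obtain ⟨X, Y, Z, hS⟩ := h
  refine (S.coupledRankEq_iff m n J K hK₀).2 fun x hB hD => ?_
  -- With `D (i + 1) (x (i + 1)) = -G i (x i)`, the two terms in which a `Z j` occurs match the
  -- alternating signs of the `E i`. At `n + 1` there is no `D`, and `G n` takes its place.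
  obtain ⟨y, hy, hyn⟩ : ∃ y : ∀ j, Fin (S.s j) → ℍ[ℝ],
      (∀ j, j ≤ n → y j = (-1 : ℤ) ^ (j - m) • (Z j *ᵥ S.D j *ᵥ x j)) ∧
      y (n + 1) = (-1 : ℤ) ^ (n - m) • (Z (n + 1) *ᵥ S.G n *ᵥ x n) :=
    ⟨Function.update (fun j => (-1 : ℤ) ^ (j - m) • (Z j *ᵥ S.D j *ᵥ x j)) (n + 1) _,
      fun j hj => Function.update_of_ne (by omega) _ _, Function.update_self _ _ _⟩
  refine ⟨y, fun i => (-1 : ℤ) ^ (i - m) • X i *ᵥ x i, fun i hi => ?_⟩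
  obtain ⟨hmi, hin⟩ := Finset.mem_Icc.1 hi
  have hC : (if i ∈ J then S.C i *ᵥ y i else 0) =
      (-1 : ℤ) ^ (i - m) • (S.C i *ᵥ Z i *ᵥ S.D i *ᵥ x i) := by
    split_ifs with hiJ
    · rw [hy i hin, mulVec_smul]
    · obtain rfl : m = i := by
        by_contra hne
        exact hiJ (hJ i (by omega) hin)
      obtain ⟨l, rfl⟩ : ∃ l, m = l + 1 := ⟨m - 1, by omega⟩
      have := hD l (hl.resolve_left hiJ)
      rw [if_pos hi, if_neg (by simp), add_zero] at this
      rw [this, mulVec_zero, mulVec_zero, smul_zero]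
  have hF : (if i + 1 ∈ J then S.F i *ᵥ y (i + 1) else 0) =
      (-1 : ℤ) ^ (i - m) • (S.F i *ᵥ Z (i + 1) *ᵥ S.G i *ᵥ x i) := by
    rcases hin.eq_or_lt with rfl | hin'
    · split_ifs with hiJ
      · rw [hyn, mulVec_smul]
      · have := hD i (hr.resolve_left hiJ)
        rw [if_neg (by simp), if_pos hi, zero_add] at this
        rw [this, mulVec_zero, mulVec_zero, smul_zero]
    · have := hD i (hK _ (by omega) hin')
      rw [if_pos (Finset.mem_Icc.2 ⟨by omega, hin'⟩), if_pos hi] at this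
      rw [if_pos (hJ _ (by omega) hin'), hy (i + 1) hin', Nat.sub_add_comm hmi, pow_succ,
        eq_neg_of_add_eq_zero_left this, mul_neg_one, mulVec_neg, neg_smul_neg, mulVec_smul]
  rw [hC, hF, ← hS i (by omega) (by omega), mulVec_smul, ← smul_add, ← smul_add]
  congr 1
  simp only [add_mulVec, ← mulVec_mulVec, hB i hi, mulVec_zero, add_zero]
  abel

/-! ### Sufficiency of the coupled rank conditions -/

/-- The coupled rank equality solves the equations along a string, with the unknowns `Z j`
vanishing for `j ∉ J`. The signs `(-1) ^ i` pass from strings, where `G i (u i)` equals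
`D (i + 1) (u (i + 1))`, to the kernel of the coupled matrix, where these two cancel. -/
theorem CoupledRankEq.exists_lift {m n : ℕ} (hm : 1 ≤ m) {J K : Finset ℕ}
    (h : S.CoupledRankEq m n J K) (hK : K ⊆ Finset.Icc m (n + 1))
    {u : ∀ i, Fin (S.q i) → ℍ[ℝ]} (hB : ∀ i, m ≤ i → i ≤ n → S.B i *ᵥ u i = 0)
    (hu : ∀ i, m ≤ i → i < n → S.G i *ᵥ u i = S.D (i + 1) *ᵥ u (i + 1))
    (hl : m ∈ K → S.D m *ᵥ u m = 0) (hr : n + 1 ∈ K → S.G n *ᵥ u n = 0) :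
    ∃ (z : ∀ j, Fin (S.s j) → ℍ[ℝ]) (w : ∀ i, Fin (S.a i) → ℍ[ℝ]), (∀ j, j ∉ J → z j = 0) ∧
      ∀ i, m ≤ i → i ≤ n →
        S.C i *ᵥ z i + S.F i *ᵥ z (i + 1) + S.A i *ᵥ w i = S.E i *ᵥ u i := by
  have hK₀ : 0 ∉ K := fun h₀ => by simpa [show m ≠ 0 by omega] using hK h₀
  obtain ⟨y, w, hyw⟩ := (S.coupledRankEq_iff m n J K hK₀).1 h
    (fun i => (-1 : ℤ) ^ i • u i) (fun i hi => by
      obtain ⟨h₁, h₂⟩ := Finset.mem_Icc.1 hi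
      rw [mulVec_smul, hB i h₁ h₂, smul_zero]) (fun j hj => by
      obtain ⟨h₁, h₂⟩ := Finset.mem_Icc.1 (hK hj)
      simp only [mulVec_smul]
      by_cases hjm : j + 1 = m
      · subst hjm
        rw [hl hj, if_neg (show j ∉ Finset.Icc (j + 1) n by simp), smul_zero, ite_self, add_zero]
      · by_cases hjn : j = n
        · subst hjn
          rw [hr hj, if_neg (by simp), smul_zero, ite_self, add_zero]
        · rw [if_pos (Finset.mem_Icc.2 ⟨h₁, by omega⟩),
            if_pos (Finset.mem_Icc.2 ⟨by omega, by omega⟩), hu j (by omega) (by omega), pow_succ,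
            mul_neg_one, neg_smul, neg_add_cancel])
  refine ⟨fun j => if j ∈ J then (-1 : ℤ) ^ m • y j else 0, fun i => (-1 : ℤ) ^ m • w i,
    fun j hj => if_neg hj, fun i h₁ h₂ => ?_⟩
  have := congrArg (fun v => (-1 : ℤ) ^ m • v) (hyw i (Finset.mem_Icc.2 ⟨h₁, h₂⟩))
  have hsign : (-1 : ℤ) ^ m * ((-1) ^ (i - m) * (-1) ^ i) = 1 := by
    rw [← mul_assoc, ← pow_add, Nat.add_sub_cancel' h₁, ← mul_pow]
    simp
  simp only [mulVec_smul, smul_smul, smul_add, hsign, one_smul] at this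
  rw [← this, mulVec_smul]
  congr 2
  · dsimp only
    split_ifs
    · rw [mulVec_smul]
    · rw [mulVec_zero, smul_zero]
  · dsimp only
    split_ifs
    · rw [mulVec_smul]
    · rw [mulVec_zero, smul_zero]

theorem consistent_of_coupledRankEq {k : ℕ}
    (h : ∀ m n, 1 ≤ m → m ≤ n → n ≤ k →
      S.CoupledRankEq m n (Finset.Icc m (n + 1)) (Finset.Icc (m + 1) n) ∧
      S.CoupledRankEq m n (Finset.Icc (m + 1) n) (Finset.Icc m (n + 1)) ∧
      S.CoupledRankEq m n (Finset.Icc m n) (Finset.Icc (m + 1) (n + 1)) ∧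
      S.CoupledRankEq m n (Finset.Icc (m + 1) (n + 1)) (Finset.Icc m n)) :
    S.Consistent k := by
  have hlift : LiftsStrings (fun i => colMap (S.D i)) (fun i => colMap (S.G i))
      (fun i => (LinearMap.range (colMap (S.A i))).mkQ ∘ₗ colMap (S.C i))
      (fun i => (LinearMap.range (colMap (S.A i))).mkQ ∘ₗ colMap (S.F i))
      (fun i => (LinearMap.range (colMap (S.A i))).mkQ ∘ₗ colMap (S.E i)) 1 (k + 1)
      (fun i => LinearMap.ker (colMap (S.B i))) := by
    intro m n hm hmn hnk u hB hu l o hl ho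
    -- At an open end the unknown is available (in `J`); at a closed end the string is
    -- constrained (by `K`).
    obtain ⟨J, K, hS, hK, hlJ, hoJ, hlK, hoK⟩ : ∃ J K, S.CoupledRankEq m n J K ∧
        K ⊆ Finset.Icc m (n + 1) ∧ (¬ l → m ∉ J) ∧ (¬ o → n + 1 ∉ J) ∧ (l → m ∉ K) ∧
        (o → n + 1 ∉ K) := by
      obtain ⟨h₁, h₂, h₃, h₄⟩ := h m n hm hmn (by omega)
      by_cases hl : l <;> by_cases ho : o
      · exact ⟨_, _, h₁, Finset.Icc_subset_Icc (by omega) (by omega), by simp [hl], by simp [ho],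
          by simp, by simp⟩
      · exact ⟨_, _, h₃, Finset.Icc_subset_Icc (by omega) (by omega), by simp [hl], by simp,
          by simp, by simp [ho]⟩
      · exact ⟨_, _, h₄, Finset.Icc_subset_Icc (by omega) (by omega), by simp, by simp [ho],
          by simp [hl], by simp⟩
      · exact ⟨_, _, h₂, Finset.Icc_subset_Icc (by omega) (by omega), by simp, by simp,
          by simp [hl], by simp [ho]⟩
    obtain ⟨z, w, hz, hzw⟩ := hS.exists_lift hm hK (u := u) hB hu
      (fun hm => hl fun hl => hlK hl hm) (fun hn => ho fun ho => hoK ho hn)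
    refine ⟨z, fun hl => hz _ (hlJ hl), fun ho => hz _ (hoJ ho), fun i h₁ h₂ => ?_⟩
    simp only [LinearMap.comp_apply, colMap_apply]
    rw [← map_add, ← hzw i h₁ h₂, Submodule.mkQ_apply, Submodule.mkQ_apply, Submodule.Quotient.eq]
    exact ⟨-w i, by rw [colMap_apply, mulVec_neg]; abel⟩
  obtain ⟨ζ, hζ⟩ := hlift.exists_section
  choose Z hZ using fun j => exists_colMap_eq (ζ j)
  have hXY : ∀ i, ∃ (X : Matrix (Fin (S.a i)) (Fin (S.q i)) ℍ[ℝ])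
      (Y : Matrix (Fin (S.p i)) (Fin (S.b i)) ℍ[ℝ]), 1 ≤ i → i ≤ k →
      S.A i * X + Y * S.B i = S.E i - S.C i * Z i * S.D i - S.F i * Z (i + 1) * S.G i := by
    intro i
    by_cases hi : 1 ≤ i ∧ i ≤ k
    · obtain ⟨X, Y, hXY⟩ := exists_mul_add_mul_eq
        (S.E i - S.C i * Z i * S.D i - S.F i * Z (i + 1) * S.G i) (S.A i) (S.B i) fun x hx => by
          have := hζ i hi.1 (by omega) x hx
          simp only [LinearMap.comp_apply, colMap_apply] at this
          rw [← map_add, eq_comm, Submodule.mkQ_apply, Submodule.mkQ_apply, Submodule.Quotient.eq,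
            ← hZ, ← hZ] at this
          obtain ⟨y, hy⟩ := this
          refine ⟨y, hy.trans ?_⟩
          simp only [sub_mulVec, ← mulVec_mulVec]
          abel
      exact ⟨X, Y, fun _ _ => hXY⟩
    · exact ⟨0, 0, fun h₁ h₂ => absurd ⟨h₁, h₂⟩ hi⟩
  choose X Y hXY using hXY
  refine ⟨X, Y, Z, fun i h₁ h₂ => ?_⟩
  rw [hXY i h₁ h₂]
  abel

end SylvesterData

theorem theorem3p1 (S : SylvesterData) (k : ℕ) :
    S.Consistent k ↔
      (∀ i, 1 ≤ i → i ≤ k →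
        quatRank (fromBlocks (S.E i) (fromCols (S.A i) (fromCols (S.C i) (S.F i))) (S.B i) 0) =
            quatRank (fromCols (S.A i) (fromCols (S.C i) (S.F i))) + quatRank (S.B i) ∧
        quatRank (fromBlocks (S.E i) (S.A i) (fromRows (S.B i) (fromRows (S.D i) (S.G i))) 0) =
            quatRank (fromRows (S.B i) (fromRows (S.D i) (S.G i))) + quatRank (S.A i) ∧
        quatRank (fromBlocks (S.E i) (fromCols (S.A i) (S.C i)) (fromRows (S.B i) (S.G i)) 0) =
            quatRank (fromCols (S.A i) (S.C i)) + quatRank (fromRows (S.B i) (S.G i)) ∧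
        quatRank (fromBlocks (S.E i) (fromCols (S.A i) (S.F i)) (fromRows (S.B i) (S.D i)) 0) =
            quatRank (fromCols (S.A i) (S.F i)) + quatRank (fromRows (S.B i) (S.D i))) ∧
      (∀ m n, 1 ≤ m → m ≤ n → n ≤ k →
        S.CoupledRankEq m n (Finset.Icc m (n + 1)) (Finset.Icc (m + 1) n) ∧
        S.CoupledRankEq m n (Finset.Icc (m + 1) n) (Finset.Icc m (n + 1)) ∧
        S.CoupledRankEq m n (Finset.Icc m n) (Finset.Icc (m + 1) (n + 1)) ∧
        S.CoupledRankEq m n (Finset.Icc (m + 1) (n + 1)) (Finset.Icc m n)) := by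
  refine ⟨fun h => ⟨fun i h₁ h₂ => ?_, fun m n hm hmn hnk => ?_⟩,
    fun h => SylvesterData.consistent_of_coupledRankEq h.2⟩
  · obtain ⟨X, Y, Z, hS⟩ := h
    have hE : ∀ x, S.B i *ᵥ x = 0 → S.E i *ᵥ x = S.A i *ᵥ X i *ᵥ x +
        S.C i *ᵥ Z i *ᵥ S.D i *ᵥ x + S.F i *ᵥ Z (i + 1) *ᵥ S.G i *ᵥ x := by
      intro x hx
      rw [← hS i h₁ h₂]
      simp only [add_mulVec, ← mulVec_mulVec, hx, mulVec_zero, add_zero]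
    have hrows : ∀ {r r' : Type} (M : Matrix r (Fin (S.q i)) ℍ[ℝ])
        (N : Matrix r' (Fin (S.q i)) ℍ[ℝ]) (x : Fin (S.q i) → ℍ[ℝ]),
        fromRows M N *ᵥ x = 0 → M *ᵥ x = 0 ∧ N *ᵥ x = 0 := by
      intro r r' M N x hx
      rw [fromRows_mulVec] at hx
      exact ⟨funext fun t => congrFun hx (Sum.inl t), funext fun t => congrFun hx (Sum.inr t)⟩
    rw [add_comm (quatRank (fromRows _ (fromRows _ _)))]
    simp only [quatRank_fromBlocks_zero_iff]
    refine ⟨fun x hx => ⟨Sum.elim (X i *ᵥ x) (Sum.elim (Z i *ᵥ S.D i *ᵥ x)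
        (Z (i + 1) *ᵥ S.G i *ᵥ x)), ?_⟩, fun x hx => ⟨X i *ᵥ x, ?_⟩,
      fun x hx => ⟨Sum.elim (X i *ᵥ x) (Z i *ᵥ S.D i *ᵥ x), ?_⟩,
      fun x hx => ⟨Sum.elim (X i *ᵥ x) (Z (i + 1) *ᵥ S.G i *ᵥ x), ?_⟩⟩
    · rw [hE x hx]
      simp [fromCols_mulVec, add_assoc]
    · obtain ⟨hB, hDG⟩ := hrows _ _ _ hx
      obtain ⟨hD, hG⟩ := hrows _ _ _ hDG
      simp [hE x hB, hD, hG]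
    · obtain ⟨hB, hG⟩ := hrows _ _ _ hx
      simp [hE x hB, hG, fromCols_mulVec]
    · obtain ⟨hB, hD⟩ := hrows _ _ _ hx
      simp [hE x hB, hD, fromCols_mulVec]
  · refine ⟨h.coupledRankEq hm hnk ?_ ?_ ?_ ?_ ?_, h.coupledRankEq hm hnk ?_ ?_ ?_ ?_ ?_,
      h.coupledRankEq hm hnk ?_ ?_ ?_ ?_ ?_, h.coupledRankEq hm hnk ?_ ?_ ?_ ?_ ?_⟩ <;>
    simp only [Finset.mem_Icc] <;> omega
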